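/- Let $n$ be a nonnegative integer and let $M_n$ be the space of $n\times n$ complex matrices with the norm $\|A\|=\max_{i,j}|a_{i,j}|$. A matrix path is a continuous function $\mathcal{C}:[0,1]\to M_n$, $\alpha\mapsto\mathcal{C}_\alpha$. A $\mathcal{C}$-eigenpath set is a multiset $\{\gamma_1,\dots,\gamma_n\}$ of continuous functions $\gamma_j:[0,1]\to\mathbb{C}$ such that, for every $\alpha\in[0,1]$, the multiset $\{\gamma_1(\alpha),\dots,\gamma_n(\alpha)\}$ is the multiset of the $n$ eigenvalues of $\mathcal{C}_\alpha$, counted with algebraic multiplicity. Let $\varepsilon>0$ and let $\mathcal{C}$ be a matrix path. Then there is a $\delta>0$ such that for any matrix path $\mathcal{C}'$ with $\|\mathcal{C}_\alpha-\mathcal{C}'_\alpha\|<\delta$ for all $\alpha\in[0,1]$ and any $\mathcal{C}'$-eigenpath set $\{\gamma'_1,\dots,\gamma'_n\}$, there is a $\mathcal{C}$-eigenpath set $\{\gamma_1,\dots,\gamma_n\}$ satisfying $|\gamma_j(\alpha)-\gamma'_j(\alpha)|<\varepsilon$ for all $\alpha\in[0,1]$ and all $j=1,\dots,n$. -/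

import Mathlib

/- The norm on matrices is the entrywise maximum norm `‖A‖ = max_{i,j} |a_{i,j}|`. -/
attribute [local instance] Matrix.normedAddCommGroup

/-- A matrix path: a continuous function from `[0,1]` to the `n`-by-`n` complex matrices. -/
abbrev MatrixPath (n : ℕ) : Type :=
  C(unitInterval, Matrix (Fin n) (Fin n) ℂ)

/-- The multiset spectrum of a complex matrix: its eigenvalues with algebraic multiplicity. -/
noncomputable def multisetSpectrum {n : ℕ} (A : Matrix (Fin n) (Fin n) ℂ) : Multiset ℂ :=
  A.charpoly.roots

/-- A multiset `Γ` of continuous functions `[0,1] → ℂ` is an eigenpath set of the matrix path `C`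
if, at each `α`, the values of its members at `α` are the eigenvalues of `C α`, as a multiset.
(Its cardinality is then necessarily `n`.) -/
def IsEigenpathSet {n : ℕ} (C : MatrixPath n) (Γ : Multiset C(unitInterval, ℂ)) : Prop :=
  ∀ α : unitInterval, multisetSpectrum (C α) = Γ.map (fun γ => γ α)

/-- The multiset `{γ_1, …, γ_n}` listed by a family of continuous functions, with repetitions. -/
def pathMultiset {n : ℕ} (γ : Fin n → C(unitInterval, ℂ)) : Multiset C(unitInterval, ℂ) :=
  (Finset.univ : Finset (Fin n)).val.map γ

/-!
The argument is by compactness. If the claim fails for some `ε`, there are matrix paths `C k`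
converging uniformly to `C`, with continuous eigenvalue listings `γ k`, such that no continuous
eigenvalue listing of `C` is within `ε` of any `γ k`.

The listings `γ k` are uniformly bounded by Gershgorin's theorem. They are also equicontinuous
(`equicontinuous_of_det_eq_prod`). Indeed, the matrix paths `C k` and `C` form a compact set, so for
`x` near `x₀` every root of the characteristic polynomial of `C k x` lies within a small `r` of a
root of that of `C k x₀`, uniformly in `k`. A path `γ k i` restricted to a connected neighbourhood
of `x₀` therefore stays in a union of `n` balls of radius `r`, and a connected subset of such a union
has diameter at most `2nr` (`IsPreconnected.dist_le_of_forall_exists_dist_lt`).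

By the Arzelà–Ascoli theorem a subsequence of `γ k` converges uniformly to some `G`. The identity
`det (z - C k α) = ∏ i, (z - γ k i α)` passes to the limit, so `G` lists the eigenvalues of `C`,
while `γ k` is eventually within `ε` of `G` along the subsequence: a contradiction.
-/

/-- The multiset of paths listed by `γ` is an eigenpath set of `C` exactly when the characteristic
polynomial of `C α` splits as `∏ (z - γ i α)`. This form is an identity between continuous
functions, so it survives pointwise limits in both `C` and `γ`. -/
theorem isEigenpathSet_pathMultiset_iff {n : ℕ} (C : MatrixPath n)
    (γ : Fin n → C(unitInterval, ℂ)) :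
    IsEigenpathSet C (pathMultiset γ) ↔
      ∀ (α : unitInterval) (z : ℂ), (Matrix.scalar (Fin n) z - C α).det = ∏ i, (z - γ i α) := by
  have key : ∀ α : unitInterval, (pathMultiset γ).map (fun γ => γ α) =
      (Finset.univ : Finset (Fin n)).val.map fun i => γ i α := by
    intro α
    rw [pathMultiset, Multiset.map_map]
    rfl
  refine forall_congr' fun α => ?_
  rw [key, multisetSpectrum]
  constructor
  · intro h z
    rw [← Matrix.eval_charpoly, (IsAlgClosed.splits (C α).charpoly).eq_prod_roots_of_monic
      (C α).charpoly_monic, h, Multiset.map_map, Polynomial.eval_multiset_prod, Multiset.map_map]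
    simp [Finset.prod]
  · intro h
    have : (C α).charpoly =
        (((Finset.univ : Finset (Fin n)).val.map fun i => γ i α).map
          fun a => Polynomial.X - Polynomial.C a).prod := by
      refine Polynomial.funext fun z => ?_
      rw [Matrix.eval_charpoly, h, Polynomial.eval_multiset_prod, Multiset.map_map,
        Multiset.map_map]
      simp [Finset.prod]
    rw [this, Polynomial.roots_multiset_prod_X_sub_C]

/-- Eigenvalues are bounded by `n` times the entrywise maximum norm, by Gershgorin's theorem. -/
theorem norm_le_of_det_scalar_sub_eq_zero {n : ℕ} (A : Matrix (Fin n) (Fin n) ℂ) {z : ℂ}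
    (hz : (Matrix.scalar (Fin n) z - A).det = 0) : ‖z‖ ≤ n * ‖A‖ := by
  have hev : Module.End.HasEigenvalue (Matrix.toLin' A) z := by
    rw [Module.End.hasEigenvalue_iff_isRoot_charpoly, Matrix.charpoly_toLin', Polynomial.IsRoot,
      Matrix.eval_charpoly, hz]
  obtain ⟨k, hk⟩ := eigenvalue_mem_ball hev
  rw [mem_closedBall_iff_norm] at hk
  calc ‖z‖ = ‖A k k + (z - A k k)‖ := by rw [add_sub_cancel]
    _ ≤ ‖A k k‖ + ∑ j ∈ Finset.univ.erase k, ‖A k j‖ := (norm_add_le _ _).trans (by gcongr)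
    _ = ∑ j, ‖A k j‖ := Finset.add_sum_erase _ (fun j => ‖A k j‖) (Finset.mem_univ k)
    _ ≤ ∑ _j : Fin n, ‖A‖ := Finset.sum_le_sum fun j _ => Matrix.norm_entry_le_entrywise_sup_norm A
    _ = n * ‖A‖ := by simp

/-- A connected set covered by `n` balls of radius `r` has diameter at most `2nr`: the distances
from a fixed point of the set fill an interval, and that interval is covered by `n` intervals of
length `2r`. -/
theorem IsPreconnected.dist_le_of_forall_exists_dist_lt {E : Type*} [PseudoMetricSpace E] {n : ℕ}
    {S : Set E} (hS : IsPreconnected S) {r : ℝ} (hr : 0 ≤ r) (c : Fin n → E)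
    (hc : ∀ x ∈ S, ∃ i, dist x (c i) < r) {x y : E} (hx : x ∈ S) (hy : y ∈ S) :
    dist x y ≤ n * (2 * r) := by
  have hT : IsPreconnected ((fun w => dist w y) '' S) :=
    hS.image _ (by fun_prop)
  have hsub : Set.Icc 0 (dist x y) ⊆ ⋃ i : Fin n, Metric.ball (dist (c i) y) r := by
    intro t ht
    obtain ⟨w, hw, rfl⟩ := hT.Icc_subset ⟨y, hy, dist_self y⟩ ⟨x, hx, rfl⟩ ht
    obtain ⟨i, hi⟩ := hc w hw
    exact Set.mem_iUnion.2 ⟨i, (dist_dist_dist_le_left w (c i) y).trans_lt hi⟩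
  have hvol := (MeasureTheory.measure_mono (μ := MeasureTheory.volume) hsub).trans
    (MeasureTheory.measure_iUnion_fintype_le _ _)
  simp only [Real.volume_Icc, Real.volume_ball, sub_zero, Finset.sum_const, Finset.card_univ,
    Fintype.card_fin, nsmul_eq_mul] at hvol
  rw [← ENNReal.ofReal_natCast, ← ENNReal.ofReal_mul (by positivity)] at hvol
  exact (ENNReal.ofReal_le_ofReal_iff (by positivity)).1 hvol

/-- Continuous listings of the eigenvalues of matrix paths drawn from a compact set are
equicontinuous. Near `x₀` the eigenvalues of `f x` lie close to those of `f x₀`, uniformly in `f`,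
and connectedness keeps each path near the point where it started. -/
theorem equicontinuous_of_det_eq_prod {n : ℕ} {X ι : Type*} [TopologicalSpace X]
    [LocallyCompactSpace X] [LocallyConnectedSpace X] {K : Set C(X, Matrix (Fin n) (Fin n) ℂ)}
    (hK : IsCompact K) {R : ℝ} (f : ι → C(X, Matrix (Fin n) (Fin n) ℂ)) (hf : ∀ k, f k ∈ K)
    (γ : ι → X → Fin n → ℂ) (hγ : ∀ k, Continuous (γ k)) (hR : ∀ k x i, ‖γ k x i‖ ≤ R)
    (hdet : ∀ k x z, (Matrix.scalar (Fin n) z - f k x).det = ∏ i, (z - γ k x i)) :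
    Equicontinuous γ := by
  intro x₀
  rw [Metric.equicontinuousAt_iff_right]
  intro ε hε
  set r : ℝ := ε / (4 * (n + 1)) with hr
  have hr0 : 0 < r := by positivity
  have hnr : n * (2 * r) < ε := by
    have : (n + 1) * (4 * r) = ε := by rw [hr]; field_simp
    nlinarith [(Nat.cast_nonneg n : (0 : ℝ) ≤ n)]
  have hnear : ∀ᶠ x in nhds x₀, ∀ p ∈ K ×ˢ Metric.closedBall (0 : ℂ) R,
      ‖(Matrix.scalar (Fin n) p.2 - p.1 x₀).det - (Matrix.scalar (Fin n) p.2 - p.1 x).det‖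
        < r ^ n := by
    refine (hK.prod (isCompact_closedBall _ _)).eventually_forall_of_forall_eventually
      fun p _ => ?_
    have hcont : Continuous fun q : X × C(X, Matrix (Fin n) (Fin n) ℂ) × ℂ =>
        ‖(Matrix.scalar (Fin n) q.2.2 - q.2.1 x₀).det
          - (Matrix.scalar (Fin n) q.2.2 - q.2.1 q.1).det‖ := by
      have hs : Continuous fun z : ℂ => Matrix.scalar (Fin n) z := by
        simp only [Matrix.scalar_apply]
        fun_prop
      refine ((Continuous.matrix_det ?_).sub (Continuous.matrix_det ?_)).norm
      · exact (hs.comp (by fun_prop)).sub (by fun_prop)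
      · exact (hs.comp (by fun_prop)).sub (by fun_prop)
    refine hcont.continuousAt.eventually_lt continuousAt_const ?_
    simpa using pow_pos hr0 n
  obtain ⟨U, ⟨hUo, hxU, hUc⟩, hU⟩ :=
    (LocallyConnectedSpace.open_connected_basis x₀).mem_iff.1 hnear
  filter_upwards [hUo.mem_nhds hxU] with x hx k
  rw [dist_pi_lt_iff hε]
  intro i
  refine lt_of_le_of_lt ?_ hnr
  refine (hUc.isPreconnected.image (fun x => γ k x i)
    (by fun_prop : Continuous fun x => γ k x i).continuousOn).dist_le_of_forall_exists_dist_lt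
    hr0.le (γ k x₀) ?_ ⟨x₀, hxU, rfl⟩ ⟨x, hx, rfl⟩
  rintro _ ⟨y, hy, rfl⟩
  by_contra! hfar
  have h := hU hy (f k, γ k y i) ⟨hf k, by simpa using hR k y i⟩
  have h0 : ∏ l, (γ k y i - γ k y l) = 0 := Finset.prod_eq_zero (Finset.mem_univ i) (sub_self _)
  simp only [hdet] at h
  rw [h0, sub_zero, norm_prod] at h
  refine h.not_ge ?_
  calc r ^ n = ∏ _l : Fin n, r := by simp
    _ ≤ ∏ l, ‖γ k y i - γ k x₀ l‖ :=
      Finset.prod_le_prod (fun _ _ => hr0.le) fun l _ => by simpa [dist_eq_norm] using hfar l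

theorem unitInterval.locallyConnectedSpace : LocallyConnectedSpace unitInterval := by
  refine locallyConnectedSpace_of_connected_bases _ _ (fun _ => Metric.nhds_basis_ball)
    fun x r _ => Set.OrdConnected.isPreconnected ?_
  have h : Metric.ball x r = Subtype.val ⁻¹' Set.Ioo ((x : ℝ) - r) (x + r) := by
    rw [← Real.ball_eq_Ioo]
    rfl
  rw [h]
  exact Set.ordConnected_Ioo.preimage_mono (Subtype.mono_coe _)

theorem ContinuousMap.tendsto_of_forall_norm_sub_le {X E : Type*} [TopologicalSpace X]
    [CompactSpace X] [NormedAddCommGroup E] {f : C(X, E)} {F : ℕ → C(X, E)} {u : ℕ → ℝ}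
    (hu : Filter.Tendsto u Filter.atTop (nhds 0)) (h : ∀ k x, ‖f x - F k x‖ ≤ u k) :
    Filter.Tendsto F Filter.atTop (nhds f) := by
  rw [ContinuousMap.tendsto_iff_tendstoUniformly, Metric.tendstoUniformly_iff]
  intro e he
  filter_upwards [hu.eventually (gt_mem_nhds he)] with k hk x
  rw [dist_eq_norm]
  exact (h k x).trans_lt hk

theorem theorem1 (n : ℕ) (C : MatrixPath n) (ε : ℝ) (hε : 0 < ε) :
    ∃ δ : ℝ, 0 < δ ∧
      ∀ C' : MatrixPath n, (∀ α : unitInterval, ‖C α - C' α‖ < δ) →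
        ∀ γ' : Fin n → C(unitInterval, ℂ), IsEigenpathSet C' (pathMultiset γ') →
          ∃ γ : Fin n → C(unitInterval, ℂ), IsEigenpathSet C (pathMultiset γ) ∧
            ∀ (j : Fin n) (α : unitInterval), ‖γ j α - γ' j α‖ < ε := by
  by_contra! hneg
  choose Cs hCs γs hγs hfar using fun k : ℕ => hneg (1 / (k + 1)) Nat.one_div_pos_of_nat
  simp only [isEigenpathSet_pathMultiset_iff] at hγs hfar
  have hlim : Filter.Tendsto Cs Filter.atTop (nhds C) := by
    -- The matrix topology is the product topology, which only unfolding identifies with the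
    -- topology of the entrywise norm; `exact` performs that unfolding.
    exact ContinuousMap.tendsto_of_forall_norm_sub_le (E := Fin n → Fin n → ℂ)
      tendsto_one_div_add_atTop_nhds_zero_nat fun k α => (hCs k α).le
  have hK := hlim.isCompact_insert_range
  obtain ⟨M, hM⟩ := (isCompact_range (f := fun x => ‖C x‖)
    ((continuous_norm (E := Fin n → Fin n → ℂ)).comp C.continuous)).bddAbove
  have hR : ∀ k x i, ‖γs k i x‖ ≤ n * (M + 1) := by
    intro k x i
    have h0 : (Matrix.scalar (Fin n) (γs k i x) - Cs k x).det = 0 := by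
      rw [hγs, Finset.prod_eq_zero (Finset.mem_univ i) (sub_self _)]
    refine (norm_le_of_det_scalar_sub_eq_zero _ h0).trans ?_
    gcongr
    have hone : (1 : ℝ) / (k + 1) ≤ 1 := div_le_one_of_le₀ (by simp) (by positivity)
    linarith [norm_le_norm_add_norm_sub (C x) (Cs k x), hCs k x, hM ⟨x, rfl⟩]
  let g : ℕ → BoundedContinuousFunction unitInterval (Fin n → ℂ) := fun k =>
    BoundedContinuousFunction.mkOfCompact (ContinuousMap.pi (γs k))
  have := unitInterval.locallyConnectedSpace
  have hequi : Equicontinuous fun k x => g k x :=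
    equicontinuous_of_det_eq_prod hK Cs (fun k => Or.inr ⟨k, rfl⟩) (fun k x => g k x)
      (fun k => (g k).continuous) hR hγs
  have hcpt : IsCompact (closure (Set.range g)) := by
    refine BoundedContinuousFunction.arzela_ascoli
      (Set.univ.pi fun _ => Metric.closedBall 0 (n * (M + 1)))
      (isCompact_univ_pi fun _ => isCompact_closedBall _ _) _ ?_ ?_
    · rintro _ x ⟨k, rfl⟩ i -
      exact mem_closedBall_zero_iff.2 (hR k x i)
    · intro x
      have h := hequi x
      rw [Metric.equicontinuousAt_iff_right] at h ⊢
      intro e he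
      filter_upwards [h e he] with y hy
      rintro ⟨_, k, rfl⟩
      exact hy k
  obtain ⟨G, -, φ, hφ, hG⟩ := hcpt.tendsto_subseq fun k => subset_closure (Set.mem_range_self k)
  obtain ⟨k, hk⟩ := ((Metric.tendsto_nhds.1 hG) ε hε).exists
  obtain ⟨j, α, hjα⟩ := hfar (φ k) (fun i => ⟨fun x => G x i, by fun_prop⟩) <| by
    intro α z
    have hGα : Filter.Tendsto (fun m => g (φ m) α) Filter.atTop (nhds (G α)) :=
      ((BoundedContinuousFunction.lipschitz_eval_const α).continuous.tendsto G).comp hG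
    have hCα : Filter.Tendsto (fun m => Cs (φ m) α) Filter.atTop (nhds (C α)) :=
      ((ContinuousEvalConst.continuous_eval_const α).tendsto C).comp (hlim.comp hφ.tendsto_atTop)
    have hleft : Filter.Tendsto (fun m => (Matrix.scalar (Fin n) z - Cs (φ m) α).det) Filter.atTop
        (nhds (Matrix.scalar (Fin n) z - C α).det) :=
      ((by fun_prop : Continuous fun A : Matrix (Fin n) (Fin n) ℂ =>
        (Matrix.scalar (Fin n) z - A).det).tendsto _).comp hCα
    have hright : Filter.Tendsto (fun m => ∏ i, (z - g (φ m) α i)) Filter.atTop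
        (nhds (∏ i, (z - G α i))) :=
      ((by fun_prop : Continuous fun v : Fin n → ℂ => ∏ i, (z - v i)).tendsto _).comp hGα
    refine tendsto_nhds_unique hleft (hright.congr fun m => ?_)
    exact (hγs (φ m) α z).symm
  refine hjα.not_gt ?_
  calc ‖G α j - γs (φ k) j α‖ = dist (g (φ k) α j) (G α j) := (dist_eq_norm' _ _).symm
    _ ≤ dist (g (φ k) α) (G α) := dist_le_pi_dist _ _ j
    _ ≤ dist (g (φ k)) G := BoundedContinuousFunction.dist_coe_le_dist α
    _ < ε := hk
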